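/- Let $A,B,C$ be three qubits with state space $\mathbb{C}^2\otimes\mathbb{C}^2\otimes\mathbb{C}^2$. A two-qubit gate is a unitary operator on this space of the form $U\otimes I$, where $U$ is an arbitrary unitary on two of the three qubits ($AB$, $AC$ or $BC$) and $I$ is the identity on the remaining qubit. For a unitary $u$ on $\mathbb{C}^2$, the controlled-controlled-$u$ gate is the unitary $$|11\rangle\langle 11|_{AB}\otimes u_C+\bigl(I_{AB}-|11\rangle\langle 11|_{AB}\bigr)\otimes I_C .$$ **Lemma 4.1.** If $u$ is a $2\times 2$ unitary matrix that is not a scalar multiple of the identity, then the controlled-controlled-$u$ gate requires at least four two-qubit gates: whenever it is equal to a product $G_1G_2\cdots G_k$ of $k\ge 0$ two-qubit gates (without ancilla qubits), then $k\ge 4$. -/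

import Mathlib

/-- Labels `(a, b, c)` of the computational basis vectors `|abc⟩` of three qubits `A`, `B`, `C`. -/
abbrev ThreeQubit : Type := Fin 2 × Fin 2 × Fin 2

/-- Labels of the computational basis vectors of two qubits. -/
abbrev TwoQubit : Type := Fin 2 × Fin 2

/-- The operator `M` on the qubits `A` and `B`, tensored with the identity on `C`. -/
def actAB (M : Matrix TwoQubit TwoQubit ℂ) : Matrix ThreeQubit ThreeQubit ℂ :=
  Matrix.of fun x y => if x.2.2 = y.2.2 then M (x.1, x.2.1) (y.1, y.2.1) else 0

/-- The operator `M` on the qubits `A` and `C`, tensored with the identity on `B`. -/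
def actAC (M : Matrix TwoQubit TwoQubit ℂ) : Matrix ThreeQubit ThreeQubit ℂ :=
  Matrix.of fun x y => if x.2.1 = y.2.1 then M (x.1, x.2.2) (y.1, y.2.2) else 0

/-- The operator `M` on the qubits `B` and `C`, tensored with the identity on `A`. -/
def actBC (M : Matrix TwoQubit TwoQubit ℂ) : Matrix ThreeQubit ThreeQubit ℂ :=
  Matrix.of fun x y => if x.1 = y.1 then M (x.2.1, x.2.2) (y.2.1, y.2.2) else 0

/-- The class of two-qubit gates acting on the subsystem `AB`. -/
def gatesAB : Set (Matrix ThreeQubit ThreeQubit ℂ) :=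
  {G | ∃ U ∈ Matrix.unitaryGroup TwoQubit ℂ, G = actAB U}

/-- The class of two-qubit gates acting on the subsystem `AC`. -/
def gatesAC : Set (Matrix ThreeQubit ThreeQubit ℂ) :=
  {G | ∃ U ∈ Matrix.unitaryGroup TwoQubit ℂ, G = actAC U}

/-- The class of two-qubit gates acting on the subsystem `BC`. -/
def gatesBC : Set (Matrix ThreeQubit ThreeQubit ℂ) :=
  {G | ∃ U ∈ Matrix.unitaryGroup TwoQubit ℂ, G = actBC U}

/-- A circuit of two-qubit gates on three qubits (no ancilla): a finite sequence of gates, each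
an arbitrary unitary on one of the three pairs of qubits. Its number of gates is its length. -/
def IsTwoQubitCircuit (L : List (Matrix ThreeQubit ThreeQubit ℂ)) : Prop :=
  ∀ G ∈ L, G ∈ gatesAB ∪ gatesAC ∪ gatesBC

/-- A circuit implements `V` if the product of its gates, in the order listed, is `V`. -/
def Implements (L : List (Matrix ThreeQubit ThreeQubit ℂ))
    (V : Matrix ThreeQubit ThreeQubit ℂ) : Prop :=
  IsTwoQubitCircuit L ∧ L.prod = V

/-- The controlled-controlled-`u` gate with controls `A`, `B` and target `C`: it keeps the states
of `A` and `B` and applies `u` to `C` exactly if both are `|1⟩`. -/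
def ccGate (u : Matrix (Fin 2) (Fin 2) ℂ) : Matrix ThreeQubit ThreeQubit ℂ :=
  Matrix.of fun x y =>
    if x.1 = y.1 ∧ x.2.1 = y.2.1 then
      (if y.1 = 1 ∧ y.2.1 = 1 then u x.2.2 y.2.2 else if x.2.2 = y.2.2 then 1 else 0)
    else 0

/-! Index each gate by the qubit `q` it leaves alone, and cut operators into their blocks `⟨i|V|j⟩`
at `q`. In a product whose outer gates avoid `q` and whose middle gate avoids another qubit, every
linear combination of blocks is `P (m ⊗ 1) Q` or `P (1 ⊗ m) Q` with `P`, `Q` invertible, hence of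
even rank. The gate `ccGate u` has a combination of odd rank at every qubit, so it is no such
sandwich (`sandwich_ne_ccGate`).

If the three gates avoid three different qubits and the last one avoids a control, the triviality of
`ccGate u` on control value 0 forces the last gate to be a product operator. Its two local factors
merge into a sandwich (`distinct_ne_ccGate`). If the last gate avoids the target instead, the
adjoint reverses the order. Shorter circuits are padded with identities. -/

open Matrix Kronecker

/-! ### Ranks of block diagonal and Kronecker products -/

section Rank

variable {K m o : Type*} [Field K] [Fintype m] [DecidableEq m] [Fintype o] [DecidableEq o]

theorem Matrix.exists_eq_mul_diagonal_mul (M : Matrix m m K) :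
    ∃ (P Q : Matrix m m K) (d : m → K), P.det = 1 ∧ Q.det = 1 ∧ M = P * diagonal d * Q := by
  obtain ⟨L, L', d, h⟩ := Matrix.Pivot.exists_list_transvec_mul_diagonal_mul_list_transvec M
  exact ⟨_, _, d, TransvectionStruct.det_toMatrix_prod L, TransvectionStruct.det_toMatrix_prod L',
    h⟩

/-- Diagonalising each block by invertible factors diagonalises the whole matrix, and both ranks
count nonzero diagonal entries. -/
theorem Matrix.rank_blockDiagonal (M : o → Matrix m m K) :
    (blockDiagonal M).rank = ∑ i, (M i).rank := by
  classical
  choose P Q d hP hQ hM using fun i => Matrix.exists_eq_mul_diagonal_mul (M i)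
  have key : ∀ i, (M i).rank = Fintype.card {j // d i j ≠ 0} := by
    intro i
    rw [hM, rank_mul_eq_left_of_isUnit_det _ _ (by simp [hQ]),
      rank_mul_eq_right_of_isUnit_det _ _ (by simp [hP]), rank_diagonal]
  have hB : blockDiagonal M
      = blockDiagonal P * diagonal (fun x : m × o => d x.2 x.1) * blockDiagonal Q := by
    rw [← blockDiagonal_diagonal, ← blockDiagonal_mul, ← blockDiagonal_mul]
    exact congrArg _ (funext hM)
  rw [hB, rank_mul_eq_left_of_isUnit_det _ _ (by simp [det_blockDiagonal, hQ]),
    rank_mul_eq_right_of_isUnit_det _ _ (by simp [det_blockDiagonal, hP]), rank_diagonal]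
  simp_rw [key]
  rw [← Fintype.card_sigma]
  exact Fintype.card_congr
    ⟨fun x => ⟨x.1.2, x.1.1, x.2⟩, fun x => ⟨(x.2.1, x.1), x.2.2⟩, fun _ => rfl, fun _ => rfl⟩

theorem Matrix.rank_kronecker_one (M : Matrix m m K) :
    (M ⊗ₖ (1 : Matrix o o K)).rank = Fintype.card o * M.rank := by
  rw [kronecker_one, rank_blockDiagonal]
  simp

theorem Matrix.rank_one_kronecker (M : Matrix m m K) :
    ((1 : Matrix o o K) ⊗ₖ M).rank = Fintype.card o * M.rank := by
  rw [one_kronecker, rank_reindex, rank_blockDiagonal]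
  simp

end Rank

/-! ### Recognising product operators -/

/-- If `A ⊗ 1` times `T` is a nonzero `1 ⊗ J`, then `T` is a product operator. -/
theorem Matrix.eq_kronecker_of_kronecker_one_mul {F m n : Type*} [Field F]
    [Fintype m] [DecidableEq m] [Fintype n] [DecidableEq n]
    {A : Matrix m m F} {J : Matrix n n F} {T : Matrix (m × n) (m × n) F}
    (h : (A ⊗ₖ 1) * T = 1 ⊗ₖ J) (hJ : J ≠ 0) : ∃ a : Matrix m m F, T = a ⊗ₖ J := by
  have hA : A.det ≠ 0 := by
    -- A left null vector `v` of `A`, applied as `v ⊗ 1`, annihilates the left side and turns the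
    -- right side into `v ⊗ J`, so `J = 0`.
    intro h0
    obtain ⟨v, hv, hvA⟩ := exists_vecMul_eq_zero_iff.2 h0
    have hK : (of fun (_ : Unit) j => v j) * A = 0 := by
      ext i j
      exact congrFun hvA j
    have h2 := congrArg (((of fun (_ : Unit) j => v j) ⊗ₖ (1 : Matrix n n F)) * ·) h
    simp only [← Matrix.mul_assoc, ← mul_kronecker_mul, hK, zero_kronecker, Matrix.zero_mul,
      Matrix.mul_one, Matrix.one_mul] at h2
    obtain ⟨i, hi⟩ := Function.ne_iff.1 hv
    refine hJ (Matrix.ext fun k l => ?_)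
    have h3 := congrFun (congrFun h2 ((), k)) (i, l)
    simpa [show v i ≠ 0 from hi] using h3
  have hu : IsUnit A.det := hA.isUnit
  refine ⟨A⁻¹, ?_⟩
  have h2 := congrArg ((A⁻¹ ⊗ₖ (1 : Matrix n n F)) * ·) h
  simpa only [← Matrix.mul_assoc, ← mul_kronecker_mul, nonsing_inv_mul _ hu, one_kronecker_one,
    Matrix.one_mul, Matrix.mul_one] using h2

/-- If `1 ⊗ A` times `T` is a nonzero `J ⊗ 1`, then `T` is a product operator. -/
theorem Matrix.eq_kronecker_of_one_kronecker_mul {F m n : Type*} [Field F]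
    [Fintype m] [DecidableEq m] [Fintype n] [DecidableEq n]
    {A : Matrix m m F} {J : Matrix n n F} {T : Matrix (n × m) (n × m) F}
    (h : (1 ⊗ₖ A) * T = J ⊗ₖ 1) (hJ : J ≠ 0) : ∃ a : Matrix m m F, T = J ⊗ₖ a := by
  have swap : ∀ (X : Matrix n n F) (Y : Matrix m m F),
      (X ⊗ₖ Y).submatrix (Equiv.prodComm m n) (Equiv.prodComm m n) = Y ⊗ₖ X := by
    intro X Y
    ext i j
    simp [mul_comm]
  have h2 := congrArg (fun M => M.submatrix (Equiv.prodComm m n) (Equiv.prodComm m n)) h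
  simp only [← submatrix_mul_equiv _ _ _ (Equiv.prodComm m n), swap] at h2
  obtain ⟨a, hT⟩ := Matrix.eq_kronecker_of_kronecker_one_mul h2 hJ
  refine ⟨a, ?_⟩
  rw [← swap] at hT
  ext i j
  exact congrFun (congrFun hT i.swap) j.swap

/-! ### Gates indexed by the idle qubit, and blocks at a qubit -/

/-- The labels of three qubits, split into qubit `q` (`0, 1, 2` for `A, B, C`) and the other two. -/
def splitQubit : Fin 3 → ThreeQubit ≃ Fin 2 × TwoQubit
  | 0 => Equiv.refl _
  | 1 => ⟨fun x => (x.2.1, x.1, x.2.2), fun x => (x.2.1, x.1, x.2.2), fun _ => rfl, fun _ => rfl⟩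
  | 2 => ⟨fun x => (x.2.2, x.1, x.2.1), fun x => (x.2.1, x.2.2, x.1), fun _ => rfl, fun _ => rfl⟩

/-- The operator `M` on the two qubits other than `q`, tensored with the identity on `q`. -/
def actOff (q : Fin 3) (M : Matrix TwoQubit TwoQubit ℂ) : Matrix ThreeQubit ThreeQubit ℂ :=
  ((1 : Matrix (Fin 2) (Fin 2) ℂ) ⊗ₖ M).submatrix (splitQubit q) (splitQubit q)

theorem actOff_zero (M : Matrix TwoQubit TwoQubit ℂ) : actOff 0 M = actBC M := by
  ext x y
  simp [actOff, actBC, splitQubit, kroneckerMap_apply, one_apply]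

theorem actOff_one_eq (M : Matrix TwoQubit TwoQubit ℂ) : actOff 1 M = actAC M := by
  ext x y
  simp [actOff, actAC, splitQubit, kroneckerMap_apply, one_apply]

theorem actOff_two (M : Matrix TwoQubit TwoQubit ℂ) : actOff 2 M = actAB M := by
  ext x y
  simp [actOff, actAB, splitQubit, kroneckerMap_apply, one_apply]

theorem actOff_mul (q : Fin 3) (M N : Matrix TwoQubit TwoQubit ℂ) :
    actOff q (M * N) = actOff q M * actOff q N := by
  simp only [actOff, submatrix_mul_equiv, ← mul_kronecker_mul, Matrix.mul_one]

theorem actOff_one (q : Fin 3) : actOff q 1 = 1 := by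
  simp [actOff]

theorem actOff_star (q : Fin 3) (M : Matrix TwoQubit TwoQubit ℂ) :
    actOff q (star M) = star (actOff q M) := by
  simp [actOff, star_eq_conjTranspose, conjTranspose_kronecker]

theorem isUnit_det_actOff (q : Fin 3) (M : Matrix TwoQubit TwoQubit ℂ) :
    IsUnit (actOff q M).det ↔ IsUnit M.det := by
  simp [actOff, det_kronecker]

/-- The block `⟨i|V|j⟩` of `V` with respect to qubit `q`. -/
def sliceAt (q : Fin 3) (i j : Fin 2) (V : Matrix ThreeQubit ThreeQubit ℂ) :
    Matrix TwoQubit TwoQubit ℂ :=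
  of fun x y => V ((splitQubit q).symm (i, x)) ((splitQubit q).symm (j, y))

theorem sliceAt_mul (q : Fin 3) (i j : Fin 2) (V W : Matrix ThreeQubit ThreeQubit ℂ) :
    sliceAt q i j (V * W) = ∑ k, sliceAt q i k V * sliceAt q k j W := by
  ext x y
  rw [Matrix.sum_apply]
  simp only [sliceAt, mul_apply, of_apply]
  rw [← (splitQubit q).symm.sum_comp, Fintype.sum_prod_type]

theorem sliceAt_actOff_self (q : Fin 3) (i j : Fin 2) (M : Matrix TwoQubit TwoQubit ℂ) :
    sliceAt q i j (actOff q M) = if i = j then M else 0 := by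
  ext x y
  split_ifs with h <;> simp [sliceAt, actOff, kroneckerMap_apply, h]

theorem sliceAt_actOff_mul (q : Fin 3) (i j : Fin 2) (P : Matrix TwoQubit TwoQubit ℂ)
    (V : Matrix ThreeQubit ThreeQubit ℂ) :
    sliceAt q i j (actOff q P * V) = P * sliceAt q i j V := by
  simp [sliceAt_mul, sliceAt_actOff_self]

theorem sliceAt_mul_actOff (q : Fin 3) (i j : Fin 2) (P : Matrix TwoQubit TwoQubit ℂ)
    (V : Matrix ThreeQubit ThreeQubit ℂ) :
    sliceAt q i j (V * actOff q P) = sliceAt q i j V * P := by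
  simp [sliceAt_mul, sliceAt_actOff_self]

/-- Slices at `q` of operators acting trivially on `r` are local to the first remaining qubit. -/
def SlicesLeft (q r : Fin 3) : Prop :=
  ∀ (M : Matrix TwoQubit TwoQubit ℂ) (i j : Fin 2),
    ∃ m : Matrix (Fin 2) (Fin 2) ℂ, sliceAt q i j (actOff r M) = m ⊗ₖ 1

/-- Slices at `q` of operators acting trivially on `r` are local to the second remaining qubit. -/
def SlicesRight (q r : Fin 3) : Prop :=
  ∀ (M : Matrix TwoQubit TwoQubit ℂ) (i j : Fin 2),
    ∃ m : Matrix (Fin 2) (Fin 2) ℂ, sliceAt q i j (actOff r M) = 1 ⊗ₖ m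

theorem slicesLeft_zero_two : SlicesLeft 0 2 := fun M i j =>
  ⟨of fun x y => M (i, x) (j, y), by
    ext x y; simp [sliceAt, actOff, splitQubit, kroneckerMap_apply, one_apply]⟩

theorem slicesRight_zero_one : SlicesRight 0 1 := fun M i j =>
  ⟨of fun x y => M (i, x) (j, y), by
    ext x y; simp [sliceAt, actOff, splitQubit, kroneckerMap_apply, one_apply]⟩

theorem slicesLeft_one_two : SlicesLeft 1 2 := fun M i j =>
  ⟨of fun x y => M (x, i) (y, j), by
    ext x y; simp [sliceAt, actOff, splitQubit, kroneckerMap_apply, one_apply]⟩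

theorem slicesRight_one_zero : SlicesRight 1 0 := fun M i j =>
  ⟨of fun x y => M (i, x) (j, y), by
    ext x y; simp [sliceAt, actOff, splitQubit, kroneckerMap_apply, one_apply]⟩

theorem slicesLeft_two_one : SlicesLeft 2 1 := fun M i j =>
  ⟨of fun x y => M (x, i) (y, j), by
    ext x y; simp [sliceAt, actOff, splitQubit, kroneckerMap_apply, one_apply]⟩

theorem slicesRight_two_zero : SlicesRight 2 0 := fun M i j =>
  ⟨of fun x y => M (x, i) (y, j), by
    ext x y; simp [sliceAt, actOff, splitQubit, kroneckerMap_apply, one_apply]⟩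

theorem slicesLeft_or_slicesRight {q r : Fin 3} (h : q ≠ r) :
    SlicesLeft q r ∨ SlicesRight q r := by
  fin_cases q <;> fin_cases r <;> first | exact absurd rfl h | skip
  · exact .inr slicesRight_zero_one
  · exact .inl slicesLeft_zero_two
  · exact .inr slicesRight_one_zero
  · exact .inl slicesLeft_one_two
  · exact .inr slicesRight_two_zero
  · exact .inl slicesLeft_two_one

/-! ### Parity of ranks: sandwiches against `ccGate` -/

/-- All blocks share an identity factor on qubit `r`, which doubles the rank. -/
theorem even_rank_sum_sliceAt_actOff {q r : Fin 3} (h : q ≠ r) (M : Matrix TwoQubit TwoQubit ℂ)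
    (c : Fin 2 → Fin 2 → ℂ) : Even (∑ i, ∑ j, c i j • sliceAt q i j (actOff r M)).rank := by
  rcases slicesLeft_or_slicesRight h with hs | hs
  · choose m hm using hs M
    have : ∑ i, ∑ j, c i j • sliceAt q i j (actOff r M)
        = (∑ i, ∑ j, c i j • m i j) ⊗ₖ (1 : Matrix (Fin 2) (Fin 2) ℂ) := by
      simp [hm, add_kronecker, smul_kronecker]
    rw [this, rank_kronecker_one, Fintype.card_fin]
    exact even_two_mul _
  · choose m hm using hs M
    have : ∑ i, ∑ j, c i j • sliceAt q i j (actOff r M)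
        = (1 : Matrix (Fin 2) (Fin 2) ℂ) ⊗ₖ (∑ i, ∑ j, c i j • m i j) := by
      simp [hm, kronecker_add, kronecker_smul]
    rw [this, rank_one_kronecker, Fintype.card_fin]
    exact even_two_mul _

theorem even_rank_sum_sliceAt_sandwich {q r : Fin 3} (h : q ≠ r)
    {P Q : Matrix TwoQubit TwoQubit ℂ} (M : Matrix TwoQubit TwoQubit ℂ)
    (hP : IsUnit P.det) (hQ : IsUnit Q.det) (c : Fin 2 → Fin 2 → ℂ) :
    Even (∑ i, ∑ j, c i j • sliceAt q i j (actOff q P * actOff r M * actOff q Q)).rank := by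
  have : ∑ i, ∑ j, c i j • sliceAt q i j (actOff q P * actOff r M * actOff q Q)
      = P * (∑ i, ∑ j, c i j • sliceAt q i j (actOff r M)) * Q := by
    simp only [sliceAt_mul_actOff, sliceAt_actOff_mul, Finset.mul_sum, Finset.sum_mul,
      Matrix.mul_smul, Matrix.smul_mul]
  rw [this, rank_mul_eq_left_of_isUnit_det _ _ hQ, rank_mul_eq_right_of_isUnit_det _ _ hP]
  exact even_rank_sum_sliceAt_actOff h M c

/-- A `2 × 2` matrix that is not scalar has rank one after subtracting an eigenvalue. -/
theorem exists_rank_sub_smul_one_eq_one {u : Matrix (Fin 2) (Fin 2) ℂ}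
    (hscalar : ¬ ∃ z : ℂ, u = z • (1 : Matrix (Fin 2) (Fin 2) ℂ)) :
    ∃ z : ℂ, (u - z • 1).rank = 1 := by
  obtain ⟨z, hz⟩ := spectrum.nonempty_of_isAlgClosed_of_finiteDimensional ℂ u
  have hdet : (u - z • (1 : Matrix (Fin 2) (Fin 2) ℂ)).det = 0 := by
    rw [spectrum.mem_iff, isUnit_iff_isUnit_det, isUnit_iff_ne_zero, not_not,
      Algebra.algebraMap_eq_smul_one, ← neg_sub, det_neg] at hz
    simpa using hz
  refine ⟨z, le_antisymm ?_ ?_⟩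
  · by_contra! h
    have h2 : (u - z • (1 : Matrix (Fin 2) (Fin 2) ℂ)).rank = 2 :=
      le_antisymm (rank_le_width _) h
    obtain ⟨v, hv, hv0⟩ := exists_mulVec_eq_zero_iff.2 hdet
    have := LinearMap.finrank_range_add_finrank_ker
      (u - z • (1 : Matrix (Fin 2) (Fin 2) ℂ)).mulVecLin
    rw [Matrix.rank] at h2
    rw [h2, Module.finrank_fin_fun] at this
    have hk : LinearMap.ker (u - z • (1 : Matrix (Fin 2) (Fin 2) ℂ)).mulVecLin = ⊥ :=
      Submodule.finrank_eq_zero.1 (by omega)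
    exact hv ((Submodule.mem_bot ℂ).1 (hk ▸ (LinearMap.mem_ker.2 hv0)))
  · rw [Nat.one_le_iff_ne_zero]
    intro h
    refine hscalar ⟨z, sub_eq_zero.1 ?_⟩
    rw [Matrix.rank, Submodule.finrank_eq_zero, LinearMap.range_eq_bot] at h
    exact toLin'.injective (by simpa only [toLin'_apply', map_zero] using h)

/-- Here `q` is a control, and the blocks are indexed by the value of the other control. The swap is
needed because `blockDiagonal` puts the block index second. -/
theorem sliceAt_ccGate_of_ne_two {q : Fin 3} (hq : q ≠ 2) (u : Matrix (Fin 2) (Fin 2) ℂ) (z : ℂ) :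
    sliceAt q 1 1 (ccGate u) - z • sliceAt q 0 0 (ccGate u)
      = reindex (Equiv.prodComm _ _) (Equiv.prodComm _ _)
        (blockDiagonal ![(1 - z) • (1 : Matrix (Fin 2) (Fin 2) ℂ), u - z • 1]) := by
  ext ⟨b, c⟩ ⟨b', c'⟩
  fin_cases q <;> first | exact absurd rfl hq | skip
  all_goals
    fin_cases b <;> fin_cases b' <;>
      simp [sliceAt, splitQubit, ccGate, blockDiagonal_apply, one_apply, ite_sub_ite]

theorem exists_odd_rank_sum_sliceAt_ccGate (q : Fin 3) {u : Matrix (Fin 2) (Fin 2) ℂ}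
    (hscalar : ¬ ∃ z : ℂ, u = z • (1 : Matrix (Fin 2) (Fin 2) ℂ)) :
    ∃ c : Fin 2 → Fin 2 → ℂ, Odd (∑ i, ∑ j, c i j • sliceAt q i j (ccGate u)).rank := by
  by_cases hq : q = 2
  · subst hq
    -- A functional that kills the identity but not `u` leaves only the entry at control values `(1,
    -- 1)`, so the rank is one.
    have hd : ∃ c : Fin 2 → Fin 2 → ℂ, c 0 0 + c 1 1 = 0 ∧ ∑ i, ∑ j, c i j * u i j ≠ 0 := by
      by_contra! h
      refine hscalar ⟨u 0 0, ?_⟩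
      have h1 := h !![0, 1; 0, 0] (by simp)
      have h2 := h !![0, 0; 1, 0] (by simp)
      have h3 := h !![-1, 0; 0, 1] (by simp)
      simp only [Fin.sum_univ_two] at h1 h2 h3
      simp at h1 h2 h3
      ext i j
      fin_cases i <;> fin_cases j <;> simp [h1, h2]
      linear_combination h3
    obtain ⟨c, hc, hcu⟩ := hd
    refine ⟨c, ?_⟩
    have : ∑ i, ∑ j, c i j • sliceAt 2 i j (ccGate u)
        = diagonal fun x : TwoQubit => if x = (1, 1) then ∑ i, ∑ j, c i j * u i j else 0 := by
      ext ⟨a, b⟩ ⟨a', b'⟩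
      fin_cases a <;> fin_cases b <;> fin_cases a' <;> fin_cases b' <;>
        simp [sliceAt, splitQubit, ccGate, Fin.sum_univ_two, hc]
    rw [this, rank_diagonal]
    have hcard : Fintype.card {x : TwoQubit //
        (if x = (1, 1) then ∑ i, ∑ j, c i j * u i j else 0) ≠ 0} = 1 := by
      rw [Fintype.card_eq_one_iff]
      exact ⟨⟨(1, 1), by simpa using hcu⟩,
        fun y => Subtype.ext (by by_contra h; exact y.2 (if_neg h))⟩
    convert odd_one
  -- With this `z`, the block `u - z • 1` contributes rank one and `(1 - z) • 1` contributes 0 or 2.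
  · obtain ⟨z, hz⟩ := exists_rank_sub_smul_one_eq_one hscalar
    refine ⟨!![-z, 0; 0, 1], ?_⟩
    have : ∑ i, ∑ j, (!![-z, 0; 0, 1] : Matrix (Fin 2) (Fin 2) ℂ) i j • sliceAt q i j (ccGate u)
        = sliceAt q 1 1 (ccGate u) - z • sliceAt q 0 0 (ccGate u) := by
      simp [Fin.sum_univ_two]
      abel
    have hrank : Even ((1 - z) • (1 : Matrix (Fin 2) (Fin 2) ℂ)).rank := by
      by_cases h : 1 - z = 0
      · simp [h]
      · rw [rank_of_isUnit _ (by
          rw [isUnit_iff_isUnit_det, det_smul, det_one, mul_one]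
          exact (pow_ne_zero _ h).isUnit)]
        exact ⟨1, rfl⟩
    erw [this]
    rw [sliceAt_ccGate_of_ne_two hq, rank_reindex, rank_blockDiagonal, Fin.sum_univ_two]
    simpa [hz] using hrank.add_odd odd_one

theorem sandwich_ne_ccGate {q r : Fin 3} (h : q ≠ r) {u : Matrix (Fin 2) (Fin 2) ℂ}
    (hscalar : ¬ ∃ z : ℂ, u = z • (1 : Matrix (Fin 2) (Fin 2) ℂ))
    {P Q : Matrix TwoQubit TwoQubit ℂ} (M : Matrix TwoQubit TwoQubit ℂ)
    (hP : IsUnit P.det) (hQ : IsUnit Q.det) :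
    actOff q P * actOff r M * actOff q Q ≠ ccGate u := by
  intro hV
  obtain ⟨c, hc⟩ := exists_odd_rank_sum_sliceAt_ccGate q hscalar
  rw [← hV] at hc
  exact Nat.not_even_iff_odd.2 hc (even_rank_sum_sliceAt_sandwich h M hP hQ c)

/-! ### Three gates on three different pairs -/

/-- On inputs whose control `q` is `|0⟩`, `ccGate u` is the identity. -/
theorem sliceAt_mul_ccGate {q : Fin 3} (hq : q ≠ 2) (i : Fin 2)
    (M : Matrix ThreeQubit ThreeQubit ℂ) (u : Matrix (Fin 2) (Fin 2) ℂ) :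
    sliceAt q i 0 (M * ccGate u) = sliceAt q i 0 M := by
  have h0 : sliceAt q 0 0 (ccGate u) = 1 := by
    ext ⟨b, c⟩ ⟨b', c'⟩
    fin_cases q <;> first | exact absurd rfl hq | skip
    all_goals simp [sliceAt, splitQubit, ccGate, one_apply, ← ite_and]
  have h1 : sliceAt q 1 0 (ccGate u) = 0 := by
    ext ⟨b, c⟩ ⟨b', c'⟩
    fin_cases q <;> first | exact absurd rfl hq | skip
    all_goals simp [sliceAt, splitQubit, ccGate]
  simp [sliceAt_mul, h0, h1]

theorem exists_sliceAt_ne_zero (q : Fin 3) {M : Matrix ThreeQubit ThreeQubit ℂ}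
    (hM : IsUnit M.det) : ∃ i, sliceAt q i 0 M ≠ 0 := by
  by_contra! h
  have h1 : sliceAt q 0 0 (M⁻¹ * M) = 0 := by simp [sliceAt_mul, h]
  rw [nonsing_inv_mul _ hM, ← actOff_one q, sliceAt_actOff_self] at h1
  simp at h1

theorem actOff_local_A (a : Matrix (Fin 2) (Fin 2) ℂ) : actOff 1 (a ⊗ₖ 1) = actOff 2 (a ⊗ₖ 1) := by
  ext x y
  simp [actOff, splitQubit, kroneckerMap_apply, one_apply, ← ite_and, and_comm]

theorem actOff_local_B (a : Matrix (Fin 2) (Fin 2) ℂ) : actOff 0 (a ⊗ₖ 1) = actOff 2 (1 ⊗ₖ a) := by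
  ext x y
  simp [actOff, splitQubit, kroneckerMap_apply, one_apply, ← ite_and, and_comm]

theorem actOff_local_C (a : Matrix (Fin 2) (Fin 2) ℂ) : actOff 0 (1 ⊗ₖ a) = actOff 1 (1 ⊗ₖ a) := by
  ext x y
  simp [actOff, splitQubit, kroneckerMap_apply, one_apply, ← ite_and, and_comm]

/-- The factors live on qubits `q₁` and `q₂`, so each can be seen as a gate avoiding the other
qubit. They commute, which makes either order available. -/
theorem exists_actOff_kronecker_eq {q₁ q₂ q₃ : Fin 3} (h₁₂ : q₁ ≠ q₂) (h₁₃ : q₁ ≠ q₃)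
    (h₂₃ : q₂ ≠ q₃) (a b : Matrix (Fin 2) (Fin 2) ℂ) :
    ∃ M N, actOff q₃ (a ⊗ₖ b) = actOff q₁ M * actOff q₂ N := by
  have hab : a ⊗ₖ b = (a ⊗ₖ 1) * (1 ⊗ₖ b) := by simp [← mul_kronecker_mul]
  have hba : a ⊗ₖ b = (1 ⊗ₖ b) * (a ⊗ₖ 1) := by simp [← mul_kronecker_mul]
  have hab' := congrArg (actOff q₃) hab
  have hba' := congrArg (actOff q₃) hba
  rw [actOff_mul] at hab' hba'
  fin_cases q₁ <;> fin_cases q₂ <;> fin_cases q₃ <;>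
    first | exact absurd rfl h₁₂ | exact absurd rfl h₁₃ | exact absurd rfl h₂₃ | skip
  · exact ⟨_, _, hba'.trans (congrArg₂ _ (actOff_local_B b).symm (actOff_local_A a).symm)⟩
  · exact ⟨_, _, hba'.trans (congrArg₂ _ (actOff_local_C b).symm (actOff_local_A a))⟩
  · exact ⟨_, _, hab'.trans (congrArg₂ _ (actOff_local_A a).symm (actOff_local_B b).symm)⟩
  · exact ⟨_, _, hba'.trans (congrArg₂ _ (actOff_local_C b) (actOff_local_B a))⟩
  · exact ⟨_, _, hab'.trans (congrArg₂ _ (actOff_local_A a) (actOff_local_C b).symm)⟩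
  · exact ⟨_, _, hab'.trans (congrArg₂ _ (actOff_local_B a) (actOff_local_C b))⟩

theorem slicesLeft_and_slicesRight_or {q₁ q₂ q₃ : Fin 3} (h₁₂ : q₁ ≠ q₂) (h₁₃ : q₁ ≠ q₃)
    (h₂₃ : q₂ ≠ q₃) :
    SlicesLeft q₃ q₂ ∧ SlicesRight q₃ q₁ ∨ SlicesRight q₃ q₂ ∧ SlicesLeft q₃ q₁ := by
  fin_cases q₁ <;> fin_cases q₂ <;> fin_cases q₃ <;>
    first | exact absurd rfl h₁₂ | exact absurd rfl h₁₃ | exact absurd rfl h₂₃ | skip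
  · exact .inl ⟨slicesLeft_two_one, slicesRight_two_zero⟩
  · exact .inl ⟨slicesLeft_one_two, slicesRight_one_zero⟩
  · exact .inr ⟨slicesRight_two_zero, slicesLeft_two_one⟩
  · exact .inl ⟨slicesLeft_zero_two, slicesRight_zero_one⟩
  · exact .inr ⟨slicesRight_one_zero, slicesLeft_one_two⟩
  · exact .inr ⟨slicesRight_zero_one, slicesLeft_zero_two⟩

theorem distinct_ne_ccGate {q₁ q₂ q₃ : Fin 3} (h₁₂ : q₁ ≠ q₂) (h₁₃ : q₁ ≠ q₃) (h₂₃ : q₂ ≠ q₃)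
    (h₃ : q₃ ≠ 2) {u : Matrix (Fin 2) (Fin 2) ℂ}
    (hscalar : ¬ ∃ z : ℂ, u = z • (1 : Matrix (Fin 2) (Fin 2) ℂ))
    {R T : Matrix TwoQubit TwoQubit ℂ} (S : Matrix TwoQubit TwoQubit ℂ)
    (hR : IsUnit R.det) (hT : IsUnit T.det) :
    actOff q₁ R * actOff q₂ S * actOff q₃ T ≠ ccGate u := by
  intro hV
  -- Moving `R` to the other side leaves `R⁻¹ * ccGate u`, whose column-0 blocks are those of `R⁻¹`.
  -- The two sides are local to different qubits.
  have hslice : ∀ i, sliceAt q₃ i 0 (actOff q₂ S) * T = sliceAt q₃ i 0 (actOff q₁ R⁻¹) := by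
    intro i
    rw [← sliceAt_mul_ccGate h₃ i (actOff q₁ R⁻¹) u, ← hV, ← sliceAt_mul_actOff,
      ← Matrix.mul_assoc, ← Matrix.mul_assoc, ← actOff_mul, nonsing_inv_mul _ hR,
      actOff_one, Matrix.one_mul]
  have hR' : IsUnit (R⁻¹).det := isUnit_nonsing_inv_det _ hR
  obtain ⟨i, hi⟩ := exists_sliceAt_ne_zero q₃ ((isUnit_det_actOff q₁ _).2 hR')
  have hprod : ∃ a b : Matrix (Fin 2) (Fin 2) ℂ, T = a ⊗ₖ b := by
    have hsi := hslice i
    rcases slicesLeft_and_slicesRight_or h₁₂ h₁₃ h₂₃ with ⟨h₂, h₁⟩ | ⟨h₂, h₁⟩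
    · obtain ⟨A, hA⟩ := h₂ S i 0
      obtain ⟨J, hJ⟩ := h₁ R⁻¹ i 0
      rw [hA, hJ] at hsi
      obtain ⟨a, ha⟩ := eq_kronecker_of_kronecker_one_mul hsi
        (fun h => hi (by rw [hJ, h, kronecker_zero]))
      exact ⟨a, J, ha⟩
    · obtain ⟨A, hA⟩ := h₂ S i 0
      obtain ⟨J, hJ⟩ := h₁ R⁻¹ i 0
      rw [hA, hJ] at hsi
      obtain ⟨a, ha⟩ := eq_kronecker_of_one_kronecker_mul hsi
        (fun h => hi (by rw [hJ, h, zero_kronecker]))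
      exact ⟨J, a, ha⟩
  obtain ⟨a, b, hab⟩ := hprod
  -- In this order `N` merges with `S`, and `M` avoids `q₁` just as `R` does: a sandwich.
  obtain ⟨N, M, hNM⟩ := exists_actOff_kronecker_eq h₁₂.symm h₂₃ h₁₃ a b
  have hM : IsUnit M.det := by
    rw [← isUnit_det_actOff q₃, hab, hNM, det_mul] at hT
    exact (isUnit_det_actOff q₁ _).1 (isUnit_of_mul_isUnit_right hT)
  refine sandwich_ne_ccGate h₁₂ hscalar (S * N) hR hM ?_
  rw [actOff_mul, ← hV, hab, hNM]
  simp only [Matrix.mul_assoc]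

/-! ### Case analysis and padding of short circuits -/

theorem isUnit_det_of_mem_unitaryGroup {M : Matrix TwoQubit TwoQubit ℂ}
    (h : M ∈ unitaryGroup TwoQubit ℂ) : IsUnit M.det :=
  IsUnit.of_mul_eq_one (star M).det (by rw [← det_mul, mem_unitaryGroup_iff.1 h, det_one])

theorem star_ccGate (u : Matrix (Fin 2) (Fin 2) ℂ) : star (ccGate u) = ccGate (star u) := by
  ext ⟨a, b, c⟩ ⟨a', b', c'⟩
  fin_cases a <;> fin_cases b <;> fin_cases a' <;> fin_cases b' <;>
    simp [ccGate, star_apply, apply_ite (star : ℂ → ℂ), eq_comm]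

theorem three_gates_ne_ccGate (q₁ q₂ q₃ : Fin 3) {u : Matrix (Fin 2) (Fin 2) ℂ}
    (hscalar : ¬ ∃ z : ℂ, u = z • (1 : Matrix (Fin 2) (Fin 2) ℂ))
    {R S T : Matrix TwoQubit TwoQubit ℂ} (hR : R ∈ unitaryGroup TwoQubit ℂ)
    (hS : S ∈ unitaryGroup TwoQubit ℂ) (hT : T ∈ unitaryGroup TwoQubit ℂ) :
    actOff q₁ R * actOff q₂ S * actOff q₃ T ≠ ccGate u := by
  have dR := isUnit_det_of_mem_unitaryGroup hR
  have dS := isUnit_det_of_mem_unitaryGroup hS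
  have dT := isUnit_det_of_mem_unitaryGroup hT
  have d1 : IsUnit (1 : Matrix TwoQubit TwoQubit ℂ).det := by simp
  by_cases h₁₂ : q₁ = q₂
  · subst h₁₂
    have dRS : IsUnit (R * S).det := by rw [det_mul]; exact dR.mul dS
    by_cases h₁₃ : q₁ = q₃
    · subst h₁₃
      obtain ⟨r, hr⟩ := exists_ne q₁
      have := sandwich_ne_ccGate hr.symm hscalar 1 dRS dT
      rwa [actOff_one, Matrix.mul_one, actOff_mul] at this
    · have := sandwich_ne_ccGate h₁₃ hscalar T dRS d1
      rwa [actOff_one, Matrix.mul_one, actOff_mul] at this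
  by_cases h₂₃ : q₂ = q₃
  · subst h₂₃
    have := sandwich_ne_ccGate h₁₂ hscalar (S * T) dR d1
    rwa [actOff_one, Matrix.mul_one, actOff_mul, ← Matrix.mul_assoc] at this
  by_cases h₁₃ : q₁ = q₃
  · subst h₁₃
    exact sandwich_ne_ccGate h₁₂ hscalar S dR dT
  by_cases h₃ : q₃ = 2
  · have h₁ : q₁ ≠ 2 := fun h => h₁₃ (h.trans h₃.symm)
    intro hV
    have hscalar' : ¬ ∃ z : ℂ, star u = z • (1 : Matrix (Fin 2) (Fin 2) ℂ) := by
      rintro ⟨z, hz⟩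
      exact hscalar ⟨star z, by rw [← star_star u, hz, star_smul, star_one]⟩
    -- The adjoint circuit ends with the gate avoiding `q₁`, which is a control, and implements
    -- `ccGate (star u)`.
    refine distinct_ne_ccGate (Ne.symm h₂₃) (Ne.symm h₁₃) (Ne.symm h₁₂) h₁ hscalar' (star S)
      (isUnit_det_of_mem_unitaryGroup (Unitary.star_mem hT))
      (isUnit_det_of_mem_unitaryGroup (Unitary.star_mem hR)) ?_
    rw [← star_ccGate, ← hV, actOff_star, actOff_star, actOff_star, star_mul, star_mul,
      ← Matrix.mul_assoc]
  · exact distinct_ne_ccGate h₁₂ h₁₃ h₂₃ h₃ hscalar S dR dT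

theorem exists_actOff_of_mem {G : Matrix ThreeQubit ThreeQubit ℂ}
    (h : G ∈ gatesAB ∪ gatesAC ∪ gatesBC) :
    ∃ q, ∃ U ∈ unitaryGroup TwoQubit ℂ, G = actOff q U := by
  rcases h with (⟨U, hU, rfl⟩ | ⟨U, hU, rfl⟩) | ⟨U, hU, rfl⟩
  · exact ⟨2, U, hU, (actOff_two U).symm⟩
  · exact ⟨1, U, hU, (actOff_one_eq U).symm⟩
  · exact ⟨0, U, hU, (actOff_zero U).symm⟩

theorem exists_actOff_of_getD {L : List (Matrix ThreeQubit ThreeQubit ℂ)}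
    (hL : IsTwoQubitCircuit L) (i : ℕ) :
    ∃ q, ∃ U ∈ unitaryGroup TwoQubit ℂ, L.getD i 1 = actOff q U := by
  by_cases h : i < L.length
  · rw [List.getD_eq_getElem _ _ h]
    exact exists_actOff_of_mem (hL _ (List.getElem_mem h))
  · rw [List.getD_eq_default _ _ (not_lt.1 h)]
    exact ⟨0, 1, one_mem _, (actOff_one 0).symm⟩

theorem lemma4p1 (u : Matrix (Fin 2) (Fin 2) ℂ) (hu : u ∈ Matrix.unitaryGroup (Fin 2) ℂ)
    (hscalar : ¬ ∃ z : ℂ, u = z • (1 : Matrix (Fin 2) (Fin 2) ℂ))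
    (L : List (Matrix ThreeQubit ThreeQubit ℂ)) (hL : Implements L (ccGate u)) :
    4 ≤ L.length := by
  by_contra! hlen
  obtain ⟨hc, hprod⟩ := hL
  -- The default value 1 supplies identity gates for the missing positions.
  have hpad : L.getD 0 1 * L.getD 1 1 * L.getD 2 1 = L.prod := by
    match L, hlen with
    | [], _ => simp
    | [_], _ => simp
    | [_, _], _ => simp
    | [_, _, _], _ => simp [Matrix.mul_assoc]
  obtain ⟨q₁, R, hR, h₁⟩ := exists_actOff_of_getD hc 0
  obtain ⟨q₂, S, hS, h₂⟩ := exists_actOff_of_getD hc 1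
  obtain ⟨q₃, T, hT, h₃⟩ := exists_actOff_of_getD hc 2
  rw [h₁, h₂, h₃, hprod] at hpad
  exact three_gates_ne_ccGate q₁ q₂ q₃ hscalar hR hS hT hpad
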